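/- Let $d$ be a non-negative integer, let $R$ be an integral domain (for example a field or $\mathbb{Z}$), and let $\Delta$ be a finite simplicial complex with vertex set $V(\Delta)$. Suppose that $\Delta$ is a $(d-1)$-dimensional minimal cycle over $R$, that is, $\Delta$ is pure of dimension $d-1$ and there is a simplicial $(d-1)$-cycle $\zeta$ with coefficients in $R$ whose class generates the reduced homology $\widetilde H_{d-1}(\Delta;R)$ and which has a nonzero coefficient at every facet of $\Delta$. Suppose moreover that $\Delta$ is flag or, more generally, banner. Here a set $W\subseteq V(\Delta)$ is called complete if every two distinct vertices of $W$ form an edge of $\Delta$, and a complete set $W$ is called critical if $W\setminus\{v\}$ is a face of $\Delta$ for some $v\in W$ (the empty set counts as a face). The complex $\Delta$ is flag if its faces are exactly the complete sets, and the $(d-1)$-dimensional complex $\Delta$ is banner if every critical complete set of size at least $d$ is a face of $\Delta$. Then the underlying graph ($1$-skeleton) of $\Delta$ is $(2d-2)$-connected: it has at least $2d-2$ vertices, and removing any set of fewer than $2d-2$ vertices leaves a connected graph. -/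

import Mathlib

set_option maxSynthPendingDepth 5

noncomputable section

namespace AbstractSimplicialComplex

variable {V : Type*}

/-- `s` is a face of `Δ`, the empty face included (Mathlib's simplicial complexes list only
the nonempty faces). -/
def IsFace (Δ : AbstractSimplicialComplex V) (s : Finset V) : Prop :=
  s = ∅ ∨ s ∈ Δ

/-- A facet is an inclusion-maximal face. -/
def IsFacet (Δ : AbstractSimplicialComplex V) (s : Finset V) : Prop :=
  Maximal Δ.IsFace s

/-- `Δ` is pure of dimension `d - 1`: all facets have exactly `d` vertices. (If `V` is finite,
every face lies in a facet, and there is at least one facet because `∅` is a face.) -/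
def IsPure (Δ : AbstractSimplicialComplex V) (d : ℕ) : Prop :=
  ∀ s, Δ.IsFacet s → s.card = d

/-- The underlying graph (1-skeleton) of `Δ`. All elements of `V` are vertices of `Δ`. -/
def underlyingGraph [DecidableEq V] (Δ : AbstractSimplicialComplex V) : SimpleGraph V where
  Adj u v := u ≠ v ∧ ({u, v} : Finset V) ∈ Δ
  symm := ⟨fun u v h => ⟨h.1.symm, by rw [Finset.pair_comm]; exact h.2⟩⟩
  loopless := ⟨fun _ h => h.1 rfl⟩

/-- `W` is complete if any two (distinct) vertices of `W` form an edge. -/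
def IsCompleteSet [DecidableEq V] (Δ : AbstractSimplicialComplex V) (W : Finset V) : Prop :=
  ∀ u ∈ W, ∀ v ∈ W, u ≠ v → Δ.underlyingGraph.Adj u v

/-- `W` is critical if removing some vertex of `W` from `W` leaves a face. -/
def IsCritical [DecidableEq V] (Δ : AbstractSimplicialComplex V) (W : Finset V) : Prop :=
  ∃ v ∈ W, Δ.IsFace (W.erase v)

/-- `Δ` is flag: it is the clique complex of its underlying graph. -/
def IsFlag [DecidableEq V] (Δ : AbstractSimplicialComplex V) : Prop :=
  ∀ W : Finset V, Δ.IsFace W ↔ Δ.IsCompleteSet W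

/-- The banner property of a complex `Δ` of dimension `d - 1`: every critical complete set with
at least `d` elements is a face. -/
def IsBanner [DecidableEq V] (Δ : AbstractSimplicialComplex V) (d : ℕ) : Prop :=
  ∀ W : Finset V, Δ.IsCompleteSet W → Δ.IsCritical W → d ≤ W.card → Δ.IsFace W

section Homology

variable [LinearOrder V] (R : Type*) [CommRing R]

variable (V) in
/-- The simplicial boundary operator, augmentation included, on formal `R`-linear combinations of
finite subsets of `V`: `∂ {v₀ < ⋯ < vₘ} = ∑ i, (-1) ^ i • {v₀, …, vₘ} \ {vᵢ}`, and `∂ ∅ = 0`.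
The exponent `i` is the number of elements of `s` below `vᵢ`. -/
def boundaryMap : (Finset V →₀ R) →ₗ[R] (Finset V →₀ R) :=
  Finsupp.linearCombination R fun s : Finset V =>
    ∑ v ∈ s, Finsupp.single (s.erase v) ((-1 : R) ^ (s.filter (· < v)).card)

/-- Simplicial chains of dimension `k - 1`: combinations of faces with `k` vertices. -/
def chains (Δ : AbstractSimplicialComplex V) (k : ℕ) : Submodule R (Finset V →₀ R) :=
  Finsupp.supported R R {s | Δ.IsFace s ∧ s.card = k}

/-- Reduced simplicial cycles of dimension `k - 1`. -/
def cycles (Δ : AbstractSimplicialComplex V) (k : ℕ) : Submodule R (Finset V →₀ R) :=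
  Δ.chains R k ⊓ LinearMap.ker (boundaryMap V R)

/-- Simplicial boundaries of dimension `k - 1`. -/
def boundaries (Δ : AbstractSimplicialComplex V) (k : ℕ) : Submodule R (Finset V →₀ R) :=
  (Δ.chains R (k + 1)).map (boundaryMap V R)

/-- The reduced simplicial homology of `Δ` in dimension `k - 1` with coefficients in `R`. -/
abbrev reducedHomology (Δ : AbstractSimplicialComplex V) (k : ℕ) : Type _ :=
  Δ.cycles R k ⧸ (Δ.boundaries R k).submoduleOf (Δ.cycles R k)

/-- `Δ` is a `(d - 1)`-dimensional minimal cycle over `R`: it is pure of dimension `d - 1`, and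
it supports precisely one homology class in dimension `d - 1` (up to scalars: the top homology is
generated by the class of one cycle `ζ`), whose support is all of `Δ`, i.e. `ζ` has a nonzero
coefficient at every facet. Over a domain, `R`-multiples of `ζ` by nonzero scalars are nonzero,
and there are no nonzero boundaries in the top dimension, so the top homology is then free of
rank one on the class of `ζ`. -/
def IsMinimalCycle (Δ : AbstractSimplicialComplex V) (d : ℕ) : Prop :=
  Δ.IsPure d ∧ ∃ ζ : Δ.cycles R d,
    (∀ s : Finset V, Δ.IsFacet s ↔ (ζ : Finset V →₀ R) s ≠ 0) ∧
    Submodule.span R {(Submodule.Quotient.mk ζ : Δ.reducedHomology R d)} = ⊤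

end Homology

end AbstractSimplicialComplex

/-- `G` is `k`-connected: it has at least `k` vertices, and deleting any set of fewer than `k`
vertices leaves a connected graph. -/
def SimpleGraph.IsKConnected {V : Type*} (G : SimpleGraph V) (k : ℕ) : Prop :=
  k ≤ Nat.card V ∧
    ∀ S : Finset V, S.card < k → (G.induce ((S : Set V)ᶜ)).Connected

end

namespace AbstractSimplicialComplex

/-! Suppose fewer than $2d-2$ vertices `S` separate the graph, and let `A` be a component of the
rest. Let $\zeta_A$ be the part of `ζ` on faces meeting `A`. A face meeting `A` lies in `A ∪ S`, so
$\partial\zeta_A$ is a cycle on $(d-1)$-sets inside `S`. If it bounds a chain `η` of faces inside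
`S`, then $\zeta_A-\eta$ is a top cycle, hence $r\zeta$. It vanishes at a facet through a vertex
outside `A ∪ S`, so $r=0$ over a domain; yet it equals $\zeta\ne0$ at a facet through a vertex of
`A`.

The filling `η` comes from `IsBannerFamily.exists_boundaryMap_eq`: fewer than $2k$ vertices cannot
carry homology on $k$-sets. If `u`, `v` span no edge, use Mayer-Vietoris at `v`: the link loses both
`u` and `v` while $k$ drops by one, and the deletion loses `v`. If there is no non-edge, the banner
condition grows a $k$-face into the full simplex. The same lemma on all of `V` with $k=d$ bounds the
number of vertices. -/

theorem mem_supported_of_forall {V R : Type*} [CommRing R] {F G : Set (Finset V)} {c : Finset V →₀ R}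
    (hc : c ∈ Finsupp.supported R R F) (h : ∀ s ∈ F, s ∈ G) : c ∈ Finsupp.supported R R G :=
  Finsupp.supported_mono h hc

/-! ### Boundary and cone operators on chains -/

section ChainOperators

variable {V : Type*} [LinearOrder V] {R : Type*} [CommRing R]

theorem boundaryMap_single (s : Finset V) (a : R) :
    boundaryMap V R (Finsupp.single s a) =
      ∑ v ∈ s, Finsupp.single (s.erase v) (a * (-1 : R) ^ (s.filter (· < v)).card) := by
  simp [boundaryMap, Finset.smul_sum]

variable (R) in
/-- Exterior multiplication by the vertex `v`: a finite set `s` not containing `v` is sent to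
`insert v s`, with the sign that sorts it, and a set containing `v` is sent to `0`. -/
noncomputable def coneMap (v : V) : (Finset V →₀ R) →ₗ[R] (Finset V →₀ R) :=
  Finsupp.linearCombination R fun s : Finset V =>
    if v ∈ s then 0 else Finsupp.single (insert v s) ((-1 : R) ^ (s.filter (· < v)).card)

theorem coneMap_single_of_mem {v : V} {s : Finset V} (h : v ∈ s) (a : R) :
    coneMap R v (Finsupp.single s a) = 0 := by
  simp [coneMap, h]

theorem coneMap_single_of_notMem {v : V} {s : Finset V} (h : v ∉ s) (a : R) :
    coneMap R v (Finsupp.single s a) =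
      Finsupp.single (insert v s) (a * (-1 : R) ^ (s.filter (· < v)).card) := by
  simp [coneMap, h]

theorem boundaryMap_mem_supported {F G : Set (Finset V)}
    {c : Finset V →₀ R} (hc : c ∈ Finsupp.supported R R F)
    (h : ∀ s ∈ F, ∀ v ∈ s, s.erase v ∈ G) : boundaryMap V R c ∈ Finsupp.supported R R G := by
  rw [boundaryMap, Finsupp.linearCombination_apply]
  refine Submodule.sum_mem _ fun s hs => Submodule.smul_mem _ _ (Submodule.sum_mem _ fun v hv => ?_)
  exact Finsupp.single_mem_supported R _ (h s (hc hs) v hv)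

theorem coneMap_mem_supported {F G : Set (Finset V)} {v : V}
    {c : Finset V →₀ R} (hc : c ∈ Finsupp.supported R R F)
    (h : ∀ s ∈ F, v ∉ s → insert v s ∈ G) : coneMap R v c ∈ Finsupp.supported R R G := by
  rw [coneMap, Finsupp.linearCombination_apply]
  refine Submodule.sum_mem _ fun s hs => Submodule.smul_mem _ _ ?_
  split_ifs with hv
  · exact Submodule.zero_mem _
  · exact Finsupp.single_mem_supported R _ (h s (hc hs) hv)

theorem coneMap_eq_zero {v : V} {c : Finset V →₀ R}
    (hc : c ∈ Finsupp.supported R R {s | v ∈ s}) : coneMap R v c = 0 := by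
  rw [coneMap, Finsupp.linearCombination_apply]
  refine Finset.sum_eq_zero fun s hs => ?_
  have hv : v ∈ s := hc hs
  simp [hv]

theorem boundaryMap_coneMap_add_single (v : V) (s : Finset V) :
    boundaryMap V R (coneMap R v (Finsupp.single s 1)) +
      coneMap R v (boundaryMap V R (Finsupp.single s 1)) = Finsupp.single s 1 := by
  by_cases hv : v ∈ s
  · rw [coneMap_single_of_mem hv, map_zero, zero_add, boundaryMap_single, map_sum,
      Finset.sum_eq_single_of_mem v hv, coneMap_single_of_notMem (Finset.notMem_erase v s),
      Finset.insert_erase hv]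
    · have : (s.erase v).filter (· < v) = s.filter (· < v) := by
        ext x; simp only [Finset.mem_filter, Finset.mem_erase]; grind
      rw [this, one_mul, ← mul_pow]; simp
    · intro u _ huv
      exact coneMap_single_of_mem (Finset.mem_erase.2 ⟨huv.symm, hv⟩) _
  · rw [coneMap_single_of_notMem hv, boundaryMap_single, boundaryMap_single,
      Finset.sum_insert hv, Finset.erase_insert hv, map_sum, add_assoc, ← Finset.sum_add_distrib,
      Finset.sum_eq_zero, add_zero]
    · have : (insert v s).filter (· < v) = s.filter (· < v) := by
        ext x; simp only [Finset.mem_filter, Finset.mem_insert]; grind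
      rw [this, one_mul, ← mul_pow]; simp
    · intro u hu
      have huv : u ≠ v := fun h => hv (h ▸ hu)
      rw [coneMap_single_of_notMem (fun h => hv (Finset.mem_of_mem_erase h)),
        Finset.erase_insert_of_ne huv.symm, ← Finsupp.single_add]
      refine (congrArg (Finsupp.single _) ?_).trans (Finsupp.single_zero _)
      -- Exactly one of the two sign exponents shifts by one: erasing `u` lowers the count below `v`
      -- if `u < v`, and inserting `v` raises the count below `u` otherwise. So the terms cancel.
      rcases lt_or_gt_of_ne huv with h | h
      · have h1 : (insert v s).filter (· < u) = s.filter (· < u) := by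
          ext x; simp only [Finset.mem_filter, Finset.mem_insert]; grind
        have h2 : s.filter (· < v) = insert u ((s.erase u).filter (· < v)) := by
          ext x; simp only [Finset.mem_filter, Finset.mem_insert, Finset.mem_erase]; grind
        rw [h1, h2, Finset.card_insert_of_notMem (by simp)]
        ring
      · have h1 : (insert v s).filter (· < u) = insert v (s.filter (· < u)) := by
          ext x; simp only [Finset.mem_filter, Finset.mem_insert]; grind
        have h2 : (s.erase u).filter (· < v) = s.filter (· < v) := by
          ext x; simp only [Finset.mem_filter, Finset.mem_erase]; grind
        rw [h1, h2, Finset.card_insert_of_notMem (by simp [hv])]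
        ring

/-- Exterior multiplication by a vertex is a contracting homotopy of the full simplex. -/
theorem boundaryMap_coneMap_add (v : V) (c : Finset V →₀ R) :
    boundaryMap V R (coneMap R v c) + coneMap R v (boundaryMap V R c) = c := by
  have : boundaryMap V R ∘ₗ coneMap R v + coneMap R v ∘ₗ boundaryMap V R = LinearMap.id := by
    ext1 s
    ext1
    simpa using boundaryMap_coneMap_add_single v s
  exact LinearMap.congr_fun this c

/-- Apply `∂` to the homotopy identity, and the identity to `∂c`; the common term `∂K∂c` cancels.
This yields `∂∂ = 0` by induction on faces, without a double sum of signs. -/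
theorem boundaryMap_boundaryMap_coneMap (v : V) (c : Finset V →₀ R) :
    boundaryMap V R (boundaryMap V R (coneMap R v c)) =
      coneMap R v (boundaryMap V R (boundaryMap V R c)) := by
  have h1 := congrArg (boundaryMap V R) (boundaryMap_coneMap_add v c)
  have h2 := boundaryMap_coneMap_add v (boundaryMap V R c)
  rw [map_add] at h1
  exact add_right_cancel (h1.trans (h2.symm.trans (add_comm _ _)))

theorem boundaryMap_boundaryMap (c : Finset V →₀ R) :
    boundaryMap V R (boundaryMap V R c) = 0 := by
  have key : ∀ s : Finset V, ∀ a : R,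
      boundaryMap V R (boundaryMap V R (Finsupp.single s a)) = 0 := by
    intro s
    induction s using Finset.induction_on with
    | empty => intro a; simp [boundaryMap_single]
    | insert v s hv ih =>
      intro a
      -- The coefficient carries the sign in advance, so that it squares away and `single (insert v
      -- s) a` is itself a cone.
      have h := coneMap_single_of_notMem hv (a * (-1 : R) ^ (s.filter (· < v)).card)
      rw [mul_assoc, ← mul_pow] at h
      simp only [neg_mul_neg, one_pow, mul_one] at h
      rw [← h, boundaryMap_boundaryMap_coneMap, ih, map_zero]
  induction c using Finsupp.induction_linear with
  | zero => simp
  | add f g hf hg => rw [map_add, map_add, hf, hg, add_zero]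
  | single s a => exact key s a

end ChainOperators

/-! ### Vanishing of homology for banner families on few vertices -/

section BannerAcyclicity

variable {V : Type*} [LinearOrder V]

/-- The banner condition for a family of finite sets: a complete set with at least `d` elements
is in the family if it becomes so on removing one of its vertices. -/
def IsBannerFamily (F : Set (Finset V)) (d : ℕ) : Prop :=
  ∀ W : Finset V, (∀ u ∈ W, ∀ v ∈ W, u ≠ v → {u, v} ∈ F) → (∃ v ∈ W, W.erase v ∈ F) →
    d ≤ W.card → W ∈ F

theorem IsBannerFamily.mono {F : Set (Finset V)} {d e : ℕ} (h : IsBannerFamily F d)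
    (hde : d ≤ e) : IsBannerFamily F e :=
  fun W h1 h2 h3 => h W h1 h2 (hde.trans h3)

/-- With at least two elements in `W`, each lies in some pair of the family, which places it in `S`.
-/
theorem IsBannerFamily.inter_subset {F : Set (Finset V)} {d : ℕ} (h : IsBannerFamily F d)
    (hd : 2 ≤ d) (S : Set V) : IsBannerFamily (F ∩ {s | (s : Set V) ⊆ S}) d := by
  intro W h1 h2 h3
  refine ⟨h W (fun u hu v hv huv => (h1 u hu v hv huv).1) (h2.imp fun v hv => ⟨hv.1, hv.2.1⟩) h3, ?_⟩
  intro u hu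
  obtain ⟨v, hv, hvu⟩ := Finset.exists_mem_ne (by omega : 1 < W.card) u
  exact (h1 u hu v hv hvu.symm).2 (by simp)

/-- A complete critical set of the link, with `v` added, is complete and critical in `F`, with one
more element. -/
theorem IsBannerFamily.link {F : Set (Finset V)} {d : ℕ} (h : IsBannerFamily F (d + 1))
    (hF : IsLowerSet F) (hd : 2 ≤ d) (v : V) :
    IsBannerFamily {s | v ∉ s ∧ insert v s ∈ F} d := by
  intro W h1 h2 h3
  have hvW : v ∉ W := by
    intro hv
    obtain ⟨u, hu, huv⟩ := Finset.exists_mem_ne (by omega : 1 < W.card) v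
    exact (h1 v hv u hu huv.symm).1 (by simp)
  refine ⟨hvW, h _ ?_ ?_ (by rw [Finset.card_insert_of_notMem hvW]; omega)⟩
  · have hadj : ∀ u ∈ W, {v, u} ∈ F := by
      intro u hu
      obtain ⟨w, hw, hwu⟩ := Finset.exists_mem_ne (by omega : 1 < W.card) u
      exact hF (by intro x; simp; grind) (h1 u hu w hw hwu.symm).2
    intro u hu w hw huw
    rw [Finset.mem_insert] at hu hw
    rcases hu with rfl | hu <;> rcases hw with rfl | hw
    · exact absurd rfl huw
    · exact hadj w hw
    · rw [Finset.pair_comm]; exact hadj u hu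
    · exact hF (Finset.subset_insert _ _) (h1 u hu w hw huw).2
  · obtain ⟨u, hu, huF⟩ := h2
    refine ⟨u, Finset.mem_insert_of_mem hu, ?_⟩
    rw [Finset.erase_insert_of_ne (ne_of_mem_of_not_mem hu hvW).symm]
    exact huF.2

/-- The Mayer-Vietoris step: a cycle in `F` bounds if the homology of the link of `v` vanishes one
dimension lower and the homology of the deletion of `v` vanishes. -/
theorem exists_boundaryMap_eq_of_link {R : Type*} [CommRing R] {F : Set (Finset V)} {l : ℕ}
    {z : Finset V →₀ R} (hF : IsLowerSet F)
    (hz : z ∈ Finsupp.supported R R {s | s ∈ F ∧ s.card = l + 1}) (hz0 : boundaryMap V R z = 0)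
    (v : V)
    (hlink : ∀ x ∈ Finsupp.supported R R
      {s | s ∈ {s | v ∉ s ∧ insert v s ∈ F} ∧ s.card = l}, boundaryMap V R x = 0 →
      ∃ w ∈ Finsupp.supported R R {s | s ∈ {s | v ∉ s ∧ insert v s ∈ F} ∧ s.card = l + 1},
        boundaryMap V R w = x)
    (hdel : ∀ x ∈ Finsupp.supported R R
      {s | s ∈ F ∩ {s | (s : Set V) ⊆ {v}ᶜ} ∧ s.card = l + 1}, boundaryMap V R x = 0 →
      ∃ w ∈ Finsupp.supported R R {s | s ∈ F ∩ {s | (s : Set V) ⊆ {v}ᶜ} ∧ s.card = l + 1 + 1},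
        boundaryMap V R w = x) :
    ∃ w ∈ Finsupp.supported R R {s | s ∈ F ∧ s.card = l + 1 + 1}, boundaryMap V R w = z := by
  set z1 := z.filter (fun s => v ∈ s)
  set z0 := z.filter (fun s => v ∉ s)
  have hsplit : z1 + z0 = z := Finsupp.filter_add_filter_not z fun s => v ∈ s
  have hmem1 : z1 ∈ Finsupp.supported R R {s | (s ∈ F ∧ s.card = l + 1) ∧ v ∈ s} := by
    intro s hs
    rw [Finsupp.support_filter, Finset.coe_filter] at hs
    exact ⟨hz hs.1, hs.2⟩
  have hmem0 : z0 ∈ Finsupp.supported R R {s | (s ∈ F ∧ s.card = l + 1) ∧ v ∉ s} := by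
    intro s hs
    rw [Finsupp.support_filter, Finset.coe_filter] at hs
    exact ⟨hz hs.1, hs.2⟩
  have hsum : boundaryMap V R z1 + boundaryMap V R z0 = 0 := by rw [← map_add, hsplit, hz0]
  have hcone : coneMap R v (boundaryMap V R z1) = z1 := by
    have h := boundaryMap_coneMap_add v z1
    rwa [coneMap_eq_zero (fun s hs => (hmem1 hs).2), map_zero, zero_add] at h
  have hb0 : boundaryMap V R z1 ∈ Finsupp.supported R R {s | v ∉ s} := by
    rw [eq_neg_of_add_eq_zero_left hsum]
    refine Submodule.neg_mem _ (boundaryMap_mem_supported hmem0 (fun s hs u hu h => ?_))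
    exact hs.2 (Finset.mem_of_mem_erase h)
  -- Only the terms erasing `v` matter: those still containing `v` cancel, by `hb0`. So `∂z1` is a
  -- cycle of the link.
  have hb1 : boundaryMap V R z1 ∈ Finsupp.supported R R
      {s | v ∉ s → insert v s ∈ F ∧ s.card = l} := by
    refine boundaryMap_mem_supported hmem1 (fun s hs u hu h => ?_)
    obtain rfl : u = v := by
      by_contra huv
      exact h (Finset.mem_erase.2 ⟨fun h => huv h.symm, hs.2⟩)
    rw [Finset.insert_erase hu, Finset.card_erase_of_mem hu, hs.1.2]
    exact ⟨hs.1.1, rfl⟩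
  obtain ⟨y, hy, hyb⟩ := hlink _ (fun s hs => ⟨⟨hb0 hs, (hb1 hs (hb0 hs)).1⟩, (hb1 hs (hb0 hs)).2⟩)
    (boundaryMap_boundaryMap z1)
  obtain ⟨w, hw, hwb⟩ := hdel (z0 + y) (by
      refine Submodule.add_mem _
        (mem_supported_of_forall hmem0 (fun s hs => ⟨⟨hs.1.1, ?_⟩, hs.1.2⟩))
        (mem_supported_of_forall hy (fun s hs => ⟨⟨hF (Finset.subset_insert _ _) hs.1.2, ?_⟩, hs.2⟩))
      · exact Set.subset_compl_singleton_iff.2 hs.2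
      · exact Set.subset_compl_singleton_iff.2 hs.1.1)
    (by rw [map_add, hyb, add_comm, hsum])
  -- The cone on `y` has boundary `y - z1`, while `∂w = z0 + y`; the difference is `z`.
  refine ⟨w - coneMap R v y, Submodule.sub_mem _
    (mem_supported_of_forall hw (fun s hs => ⟨hs.1.1, hs.2⟩))
    (coneMap_mem_supported hy (fun s hs hvs => ⟨hs.1.2, ?_⟩)), ?_⟩
  · rw [Finset.card_insert_of_notMem hvs, hs.2]
  · have h := boundaryMap_coneMap_add v y
    rw [hyb, hcone] at h
    rw [map_sub, hwb, eq_sub_of_add_eq h, ← hsplit]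
    abel

/-- A banner family on fewer than `2 * k` vertices has no homology carried by sets of
cardinality `k`. -/
theorem IsBannerFamily.exists_boundaryMap_eq {R : Type*} [CommRing R] {k : ℕ} {T : Finset V}
    {F : Set (Finset V)} (hB : IsBannerFamily F (k + 1)) (hF : IsLowerSet F)
    (hFT : ∀ s ∈ F, s ⊆ T) (hk : T.card < 2 * k) {z : Finset V →₀ R}
    (hz : z ∈ Finsupp.supported R R {s | s ∈ F ∧ s.card = k}) (hz0 : boundaryMap V R z = 0) :
    ∃ w ∈ Finsupp.supported R R {s | s ∈ F ∧ s.card = k + 1}, boundaryMap V R w = z := by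
  induction T using Finset.strongInduction generalizing k F z with
  | H T ih =>
    by_cases hT : ∃ v ∈ T, ∃ u ∈ T, u ≠ v ∧ {u, v} ∉ F
    · obtain ⟨v, hv, u, hu, huv, huvF⟩ := hT
      have hTuv : ((T.erase v).erase u).card + 2 = T.card := by
        rw [← Finset.card_erase_add_one hv,
          ← Finset.card_erase_add_one (Finset.mem_erase.2 ⟨huv, hu⟩)]
      -- Two distinct vertices in `T` force `k ≥ 2`, which the link and the deletion need.
      obtain ⟨l, rfl⟩ : ∃ l, k = l + 1 := ⟨k - 1, by omega⟩
      refine exists_boundaryMap_eq_of_link hF hz hz0 v (fun x hx hx0 => ?_) (fun y hy hy0 => ?_)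
      · refine ih ((T.erase v).erase u) ((Finset.erase_subset _ _).trans_ssubset (Finset.erase_ssubset hv))
          (k := l) (F := {s | v ∉ s ∧ insert v s ∈ F})
          (hB.link hF (by omega) v) ?_ ?_ (by omega) hx hx0
        · exact fun s t hts hs =>
            ⟨fun h => hs.1 (hts h), hF (Finset.insert_subset_insert v hts) hs.2⟩
        · intro s hs x hx
          rw [Finset.mem_erase, Finset.mem_erase]
          refine ⟨?_, ne_of_mem_of_not_mem hx hs.1, hFT _ hs.2 (Finset.mem_insert_of_mem hx)⟩
          rintro rfl
          refine huvF (hF ?_ hs.2)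
          intro y; simp; grind
      · refine ih _ (Finset.erase_ssubset hv) (k := l + 1)
          (F := F ∩ {s | (s : Set V) ⊆ {v}ᶜ}) (hB.inter_subset (by omega) _) ?_ ?_
          (by have := Finset.card_erase_le (s := T) (a := v); omega) hy hy0
        · exact fun s t hts hs =>
            ⟨hF hts hs.1, (Finset.coe_subset.2 hts).trans hs.2⟩
        · exact fun s hs x hx => Finset.mem_erase.2 ⟨hs.2 hx, hFT _ hs.1 hx⟩
    · push Not at hT
      by_cases hz' : z = 0
      · exact ⟨0, Submodule.zero_mem _, by rw [map_zero, hz']⟩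
      obtain ⟨s, hs⟩ := Finsupp.support_nonempty_iff.2 hz'
      obtain ⟨hsF, hsk⟩ := hz hs
      -- Each new vertex `a` makes a complete set, critical at `a`, of size at least `k + 1`.
      have hext : ∀ t : Finset V, t ⊆ T → s ∪ t ∈ F := by
        intro t
        induction t using Finset.induction_on with
        | empty => simpa using hsF
        | insert a t hat iht =>
          intro ht
          have hst := iht ((Finset.subset_insert _ _).trans ht)
          rw [Finset.union_insert]
          by_cases ha : a ∈ s ∪ t
          · rwa [Finset.insert_eq_of_mem ha]
          have hsub : insert a (s ∪ t) ⊆ T :=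
            Finset.insert_subset (ht (Finset.mem_insert_self _ _)) (hFT _ hst)
          refine hB _ (fun x hx y hy hxy => hT y (hsub hy) x (hsub hx) hxy)
            ⟨a, Finset.mem_insert_self _ _, by rwa [Finset.erase_insert ha]⟩ ?_
          rw [Finset.card_insert_of_notMem ha, ← hsk]
          exact Nat.succ_le_succ (Finset.card_le_card Finset.subset_union_left)
      have hTF : T ∈ F := hF Finset.subset_union_right (hext T subset_rfl)
      obtain ⟨v, hv⟩ : s.Nonempty := Finset.card_pos.1 (by omega)
      refine ⟨coneMap R v z, coneMap_mem_supported hz ?_, ?_⟩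
      · intro t ht hvt
        exact ⟨hF (Finset.insert_subset (hFT s hsF hv) (hFT t ht.1)) hTF,
          by rw [Finset.card_insert_of_notMem hvt, ht.2]⟩
      · simpa [hz0] using boundaryMap_coneMap_add v z

end BannerAcyclicity

/-! ### Pure complexes, top cycles and separation -/

section Connectivity

variable {V : Type*} {Δ : AbstractSimplicialComplex V} {d : ℕ}

theorem isLowerSet_isFace (Δ : AbstractSimplicialComplex V) : IsLowerSet {s | Δ.IsFace s} := by
  rintro s t hts (rfl | hs)
  · exact Or.inl (Finset.subset_empty.1 hts)
  · rcases t.eq_empty_or_nonempty with rfl | ht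
    · exact Or.inl rfl
    · exact Or.inr ((Δ.isRelLowerSet_faces hs).2 hts ht)

theorem isFace_singleton (Δ : AbstractSimplicialComplex V) (v : V) : Δ.IsFace {v} :=
  Or.inr (Δ.singleton_mem v)

theorem IsFace.exists_isFacet [Finite V] {s : Finset V} (hs : Δ.IsFace s) :
    ∃ t, s ⊆ t ∧ Δ.IsFacet t := by
  obtain ⟨t, hst, ht⟩ := (Set.toFinite {s | Δ.IsFace s}).exists_le_maximal hs
  exact ⟨t, hst, ht⟩

theorem IsPure.card_le [Finite V] (h : Δ.IsPure d) {s : Finset V} (hs : Δ.IsFace s) :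
    s.card ≤ d := by
  obtain ⟨t, hst, ht⟩ := hs.exists_isFacet
  exact h t ht ▸ Finset.card_le_card hst

theorem IsPure.chains_succ {R : Type*} [CommRing R] [Finite V] (h : Δ.IsPure d) : Δ.chains R (d + 1) = ⊥ := by
  rw [eq_bot_iff]
  intro c hc
  rw [Submodule.mem_bot, ← Finsupp.support_eq_empty, Finset.eq_empty_iff_forall_notMem]
  intro s hs
  have h1 : Δ.IsFace s ∧ s.card = d + 1 := hc hs
  have := h.card_le h1.1
  omega

variable [LinearOrder V] {R : Type*} [CommRing R]

theorem isFace_pair_iff {u v : V} : Δ.IsFace {u, v} ↔ {u, v} ∈ Δ :=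
  or_iff_right (Finset.insert_ne_empty u {v})

theorem IsFlag.isBanner (h : Δ.IsFlag) : Δ.IsBanner d :=
  fun W hW _ _ => (h W).2 hW

theorem IsBanner.isBannerFamily (h : Δ.IsBanner d) : IsBannerFamily {s | Δ.IsFace s} d :=
  fun W hW => h W fun u hu v hv huv => ⟨huv, isFace_pair_iff.1 (hW u hu v hv huv)⟩

/-- A pure complex has no boundaries in the top dimension, so that the top homology is the
module of top-dimensional cycles. -/
theorem IsPure.exists_eq_smul [Finite V] (h : Δ.IsPure d) {ζ : Δ.cycles R d}
    (hζ : Submodule.span R {(Submodule.Quotient.mk ζ : Δ.reducedHomology R d)} = ⊤)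
    {c : Finset V →₀ R} (hc : c ∈ Δ.cycles R d) : ∃ a : R, c = a • (ζ : Finset V →₀ R) := by
  have hmem : (Submodule.Quotient.mk ⟨c, hc⟩ : Δ.reducedHomology R d) ∈
      Submodule.span R {(Submodule.Quotient.mk ζ : Δ.reducedHomology R d)} := hζ ▸ trivial
  obtain ⟨a, ha⟩ := Submodule.mem_span_singleton.1 hmem
  rw [← Submodule.Quotient.mk_smul, Submodule.Quotient.eq, Submodule.submoduleOf,
    Submodule.mem_comap, boundaries, h.chains_succ, Submodule.map_bot, Submodule.mem_bot] at ha
  exact ⟨a, (sub_eq_zero.1 ha).symm⟩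

/-- A banner minimal cycle has at least as many vertices as a cross-polytope. -/
theorem two_mul_le_natCard [Finite V] (hpure : Δ.IsPure d) (hB : Δ.IsBanner d)
    {ζ : Finset V →₀ R} (hζ : ζ ∈ Δ.cycles R d) (h0 : ζ ≠ 0) : 2 * d ≤ Nat.card V := by
  have := Fintype.ofFinite V
  by_contra! hlt
  rw [Nat.card_eq_fintype_card, ← Finset.card_univ] at hlt
  obtain ⟨w, hw, hwz⟩ := (hB.isBannerFamily.mono d.le_succ).exists_boundaryMap_eq
    Δ.isLowerSet_isFace (fun s _ => s.subset_univ) hlt hζ.1 hζ.2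
  have hw' : w ∈ Δ.chains R (d + 1) := hw
  rw [hpure.chains_succ, Submodule.mem_bot] at hw'
  exact h0 (by rw [← hwz, hw', map_zero])

/-- If the vertices outside `S` are split into a part `A` and its complement with no edge in
between, then a top-dimensional cycle restricted to the facets meeting `A` is a cycle up to a
chain on `S`. -/
theorem exists_cycle_of_separation (hB : Δ.IsBanner (d + 1)) (hd : 1 ≤ d) {S : Finset V}
    (hS : S.card < 2 * d) {A : Set V}
    (hA : ∀ s, Δ.IsFace s → (∃ a ∈ s, a ∈ A) → (s : Set V) ⊆ A ∪ S)
    {ζ : Finset V →₀ R} (hζ : ζ ∈ Δ.cycles R (d + 1)) :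
    ∃ c ∈ Δ.cycles R (d + 1), ∀ s : Finset V, ¬ s ⊆ S →
      ((∃ a ∈ s, a ∈ A) → c s = ζ s) ∧ ((¬ ∃ a ∈ s, a ∈ A) → c s = 0) := by
  classical
  set p : Finset V → Prop := fun s => ∃ a ∈ s, a ∈ A
  have hsplit : ζ.filter p + ζ.filter (fun s => ¬ p s) = ζ := Finsupp.filter_add_filter_not ζ p
  have hmem1 : ζ.filter p ∈ Finsupp.supported R R
      {s | (Δ.IsFace s ∧ s.card = d + 1) ∧ (s : Set V) ⊆ A ∪ S} := by
    intro s hs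
    rw [Finsupp.support_filter, Finset.coe_filter] at hs
    exact ⟨hζ.1 hs.1, hA s (hζ.1 hs.1).1 hs.2⟩
  have hmem2 : ζ.filter (fun s => ¬ p s) ∈ Finsupp.supported R R {s | ¬ p s} := by
    intro s hs
    rw [Finsupp.support_filter, Finset.coe_filter] at hs
    exact hs.2
  have hneg : boundaryMap V R (ζ.filter p) = - boundaryMap V R (ζ.filter (fun s => ¬ p s)) := by
    rw [eq_neg_iff_add_eq_zero, ← map_add, hsplit]
    exact hζ.2
  have hb1 : boundaryMap V R (ζ.filter p) ∈ Finsupp.supported R R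
      {s | (Δ.IsFace s ∧ s.card = d) ∧ (s : Set V) ⊆ A ∪ S} := by
    refine boundaryMap_mem_supported hmem1 (fun s hs v hv => ⟨⟨?_, ?_⟩, ?_⟩)
    · exact Δ.isLowerSet_isFace (s.erase_subset v) hs.1.1
    · rw [Finset.card_erase_of_mem hv, hs.1.2, Nat.add_sub_cancel]
    · exact (Finset.coe_subset.2 (s.erase_subset v)).trans hs.2
  have hb2 : boundaryMap V R (ζ.filter p) ∈ Finsupp.supported R R {s | ¬ p s} := by
    rw [hneg]
    refine Submodule.neg_mem _ (boundaryMap_mem_supported hmem2 (fun s hs v hv => ?_))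
    rintro ⟨a, ha, haA⟩
    exact hs ⟨a, Finset.mem_of_mem_erase ha, haA⟩
  have hb : boundaryMap V R (ζ.filter p) ∈ Finsupp.supported R R
      {s | s ∈ {s | Δ.IsFace s} ∩ {s | (s : Set V) ⊆ S} ∧ s.card = d} := by
    intro s hs
    obtain ⟨h1, h2⟩ := hb1 hs
    exact ⟨⟨h1.1, fun x hx => (h2 hx).resolve_left fun hxA => hb2 hs ⟨x, hx, hxA⟩⟩, h1.2⟩
  obtain ⟨η, hη, hηb⟩ := (hB.isBannerFamily.inter_subset (by omega) S).exists_boundaryMap_eq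
    (fun s t hts hs => ⟨Δ.isLowerSet_isFace hts hs.1, (Finset.coe_subset.2 hts).trans hs.2⟩)
    (fun s hs => Finset.coe_subset.1 hs.2) hS hb (boundaryMap_boundaryMap _)
  -- Correcting by `η` alters only coefficients at subsets of `S`.
  refine ⟨ζ.filter p - η, ⟨Submodule.sub_mem _
    (mem_supported_of_forall hmem1 (fun s hs => hs.1))
    (mem_supported_of_forall hη (fun s hs => ⟨hs.1.1, hs.2⟩)), ?_⟩, fun s hs => ?_⟩
  · rw [SetLike.mem_coe, LinearMap.mem_ker, map_sub, hηb, sub_self]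
  · have hηs : η s = 0 := by
      by_contra h
      exact hs (Finset.coe_subset.1 (hη (Finsupp.mem_support_iff.2 h)).1.2)
    rw [Finsupp.sub_apply, hηs, sub_zero]
    exact ⟨fun h => Finsupp.filter_apply_pos p ζ h, fun h => Finsupp.filter_apply_neg p ζ h⟩

end Connectivity

end AbstractSimplicialComplex

/-! ### The connectivity theorem -/

theorem mainTheorem2 {V : Type*} [Finite V] [LinearOrder V]
    (R : Type*) [CommRing R] [IsDomain R]
    (Δ : AbstractSimplicialComplex V) (d : ℕ)
    (hcycle : Δ.IsMinimalCycle R d)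
    (hΔ : Δ.IsFlag ∨ Δ.IsBanner d) :
    Δ.underlyingGraph.IsKConnected (2 * d - 2) := by
  have hB : Δ.IsBanner d := hΔ.elim (fun h => h.isBanner) id
  obtain ⟨hpure, ζ, hζ, hspan⟩ := hcycle
  obtain ⟨s₀, -, hs₀⟩ := AbstractSimplicialComplex.IsFace.exists_isFacet (Δ := Δ) (Or.inl rfl)
  have hζ0 : (ζ : Finset V →₀ R) ≠ 0 := fun h => (hζ s₀).1 hs₀ (by rw [h]; rfl)
  have hcard := AbstractSimplicialComplex.two_mul_le_natCard hpure hB ζ.2 hζ0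
  refine ⟨by omega, fun S hS => ?_⟩
  obtain ⟨e, rfl⟩ : ∃ e, d = e + 1 := ⟨d - 1, by omega⟩
  obtain ⟨x, hx⟩ : ∃ x, x ∉ S := by
    by_contra! h
    have := Fintype.ofFinite V
    rw [Nat.card_eq_fintype_card, ← Finset.card_univ, ← Finset.eq_univ_of_forall h] at hcard
    omega
  have hne : Nonempty ((S : Set V)ᶜ : Set V) := ⟨⟨x, hx⟩⟩
  refine ⟨fun a b => ?_⟩
  by_contra hab
  set G := Δ.underlyingGraph.induce ((S : Set V)ᶜ)
  set A : Set V := {y | ∃ hy : y ∈ (S : Set V)ᶜ, G.Reachable a ⟨y, hy⟩}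
  have hA : ∀ s, Δ.IsFace s → (∃ y ∈ s, y ∈ A) → (s : Set V) ⊆ A ∪ S := by
    rintro s hs ⟨y, hys, hyS, hy⟩ w hw
    by_cases hwS : w ∈ (S : Set V)
    · exact Or.inr hwS
    refine Or.inl ⟨hwS, ?_⟩
    by_cases hyw : y = w
    · subst hyw; exact hy
    refine hy.trans (SimpleGraph.Adj.reachable ?_)
    have hadj : Δ.underlyingGraph.Adj y w :=
      ⟨hyw, AbstractSimplicialComplex.isFace_pair_iff.1 (Δ.isLowerSet_isFace
        (Finset.insert_subset hys (Finset.singleton_subset_iff.2 hw)) hs)⟩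
    exact hadj
  obtain ⟨c, hc, hcs⟩ := AbstractSimplicialComplex.exists_cycle_of_separation hB (by omega)
    (by omega) hA ζ.2
  obtain ⟨r, rfl⟩ := hpure.exists_eq_smul hspan hc
  obtain ⟨sa, hsa, hsaF⟩ := (Δ.isFace_singleton (a : V)).exists_isFacet
  obtain ⟨sb, hsb, hsbF⟩ := (Δ.isFace_singleton (b : V)).exists_isFacet
  rw [Finset.singleton_subset_iff] at hsa hsb
  -- The facet `sa` meets `A` at `a`; `sb` misses `A`, since otherwise `b` would lie in `A ∪ S`.
  have ha := (hcs sa fun h => a.2 (h hsa)).1 ⟨a, hsa, a.2, SimpleGraph.Reachable.rfl⟩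
  have hb := (hcs sb fun h => b.2 (h hsb)).2 fun h =>
    (hA sb hsbF.1 h hsb).elim (fun ⟨_, hr⟩ => hab hr) b.2
  rw [Finsupp.smul_apply, smul_eq_mul] at ha hb
  have hr : r = 0 := (mul_eq_zero.1 hb).resolve_right ((hζ sb).1 hsbF)
  rw [hr, zero_mul] at ha
  exact (hζ sa).1 hsaF ha.symm
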